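/- Let $M$ be a compact connected smooth manifold (Hausdorff, without boundary), let $\mathfrak g$ be a finite-dimensional real Lie algebra, and let $\mathcal F$ be a smooth foliation of codimension $q$ of $M$ that is - a Lie foliation with Lie algebra $\mathfrak g$: there is a smooth $\mathfrak g$-valued $1$-form $\omega$ on $M$ with $d\omega+\tfrac12[\omega,\omega]=0$, such that for every $x\in M$ the map $\omega_x:T_xM\to\mathfrak g$ is onto and has kernel $T_x\mathcal F$; - minimal: every leaf of $\mathcal F$ is dense in $M$. A vector field $Z$ on $M$ is called $\mathcal F$-foliated if it is smooth and $[Z,X]$ is tangent to $\mathcal F$ for every smooth vector field $X$ tangent to $\mathcal F$. A global transverse $\mathcal F$-foliated field is a section $\sigma$ of the normal bundle $TM/T\mathcal F$ that is induced by an $\mathcal F$-foliated vector field on $M$. An extension of $\mathcal F$ is a smooth foliation $\mathcal F'$ of $M$ of codimension $q'$ with $0<q'<q$ and $T\mathcal F\subset T\mathcal F'$; the section $\sigma$ is tangent to $\mathcal F'$ at $x$ if $\sigma(x)\in T_x\mathcal F'/T_x\mathcal F$. Then: 1. Every global transverse $\mathcal F$-foliated field that vanishes at one point of $M$ vanishes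 identically. 2. If $\mathcal F'$ is an extension of $\mathcal F$, then every global transverse $\mathcal F$-foliated field that is tangent to $\mathcal F'$ at one point of $M$ is tangent to $\mathcal F'$ at every point of $M$. -/

import Mathlib

open scoped Manifold ContDiff

noncomputable section

namespace LieFoliation

variable {E : Type*} [NormedAddCommGroup E] [NormedSpace ℝ E]
  {M : Type*} [TopologicalSpace M] [ChartedSpace E M]

/-- A `C^∞` submersion `f : U → ℝ^q`, defined on an open set `U` of `M`, whose fibres are
tangent to the field of subspaces `D`, i.e. `D y = ker (df)_y` for all `y` in `U`. -/
structure IsDistinguished {q : ℕ} (D : ∀ x : M, Submodule ℝ (TangentSpace 𝓘(ℝ, E) x))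
    (U : Set M) (f : M → EuclideanSpace ℝ (Fin q)) : Prop where
  isOpen : IsOpen U
  contMDiffOn : ContMDiffOn 𝓘(ℝ, E) 𝓘(ℝ, EuclideanSpace ℝ (Fin q)) ∞ f U
  surjective : ∀ y ∈ U,
    Function.Surjective (mfderiv 𝓘(ℝ, E) 𝓘(ℝ, EuclideanSpace ℝ (Fin q)) f y)
  ker_eq : ∀ y ∈ U, ∀ v : TangentSpace 𝓘(ℝ, E) y,
    mfderiv 𝓘(ℝ, E) 𝓘(ℝ, EuclideanSpace ℝ (Fin q)) f y v = 0 ↔ v ∈ D y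

variable (E M) in
/-- A smooth foliation of codimension `q` of the manifold `M`: it is locally defined by
submersions onto open sets of `ℝ^q`, two of which have the same tangent spaces to their fibres
where both are defined. It is recorded through its tangent bundle `x ↦ T_x F`. -/
structure Foliation (q : ℕ) where
  tangent : ∀ x : M, Submodule ℝ (TangentSpace 𝓘(ℝ, E) x)
  exists_distinguished : ∀ x : M, ∃ (U : Set M) (f : M → EuclideanSpace ℝ (Fin q)),
    x ∈ U ∧ IsDistinguished tangent U f

namespace Foliation

variable {q q' : ℕ}

/-- `x` and `y` lie in a common plaque, i.e. in a connected subset of a fibre of one of the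
submersions that define the foliation. -/
def SamePlaque (F : Foliation E M q) (x y : M) : Prop :=
  ∃ (U : Set M) (f : M → EuclideanSpace ℝ (Fin q)) (C : Set M),
    IsDistinguished F.tangent U f ∧ C ⊆ U ∧ IsPreconnected C ∧ x ∈ C ∧ y ∈ C ∧
      ∀ z ∈ C, f z = f x

/-- The leaf through `x`: all points that a finite chain of plaques joins to `x`. -/
def leaf (F : Foliation E M q) (x : M) : Set M :=
  {y | Relation.EqvGen F.SamePlaque x y}

/-- A foliation is minimal if all its leaves are dense. -/
def IsMinimal (F : Foliation E M q) : Prop :=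
  ∀ x : M, Dense (F.leaf x)

/-- `F'`, of codimension `q'`, is an extension of `F`, of codimension `q`:
`0 < q' < q` and `TF ⊆ TF'`. -/
structure IsExtension (F' : Foliation E M q') (F : Foliation E M q) : Prop where
  codim_pos : 0 < q'
  codim_lt : q' < q
  tangent_le : ∀ x : M, F.tangent x ≤ F'.tangent x

end Foliation

variable [IsManifold 𝓘(ℝ, E) ∞ M]

/-- A global vector field on `M` of class `C^∞`. -/
def IsSmoothField (X : ∀ x : M, TangentSpace 𝓘(ℝ, E) x) : Prop :=
  ContMDiff 𝓘(ℝ, E) 𝓘(ℝ, E).tangent ∞ (fun x => (⟨x, X x⟩ : TangentBundle 𝓘(ℝ, E) M))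

/-- The derivative `X · g` of the real function `g` along the vector field `X`. -/
def along (X : ∀ x : M, TangentSpace 𝓘(ℝ, E) x) (g : M → ℝ) (x : M) : ℝ :=
  mfderiv 𝓘(ℝ, E) 𝓘(ℝ, ℝ) g x (X x)

section LieAlgebraValued

variable {𝔤 : Type*} [LieRing 𝔤] [LieAlgebra ℝ 𝔤]

/-- A 1-form on `M` with values in `𝔤` is `C^∞` if its components `l ∘ η`, for `l` a linear form
on `𝔤`, send smooth vector fields to smooth functions. -/
def IsSmoothForm (η : ∀ x : M, TangentSpace 𝓘(ℝ, E) x →ₗ[ℝ] 𝔤) : Prop :=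
  ∀ (l : 𝔤 →ₗ[ℝ] ℝ) (X : ∀ x : M, TangentSpace 𝓘(ℝ, E) x), IsSmoothField X →
    ContMDiff 𝓘(ℝ, E) 𝓘(ℝ, ℝ) ∞ (fun x => l (η x (X x)))

/-- The Maurer-Cartan equation `dη + (1/2)[η, η] = 0`, evaluated on smooth vector fields `X`, `Y`
and composed with a linear form `l` on `𝔤`, where
`dη(X, Y) = X·η(Y) - Y·η(X) - η([X, Y])` and `(1/2)[η, η](X, Y) = [η(X), η(Y)]`. -/
def MaurerCartan (η : ∀ x : M, TangentSpace 𝓘(ℝ, E) x →ₗ[ℝ] 𝔤) : Prop :=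
  ∀ (l : 𝔤 →ₗ[ℝ] ℝ) (X Y : ∀ x : M, TangentSpace 𝓘(ℝ, E) x),
    IsSmoothField X → IsSmoothField Y → ∀ x : M,
      (along X (fun y => l (η y (Y y))) x - along Y (fun y => l (η y (X y))) x
        - l (η x (VectorField.mlieBracket 𝓘(ℝ, E) X Y x)))
        + l ⁅η x (X x), η x (Y x)⁆ = 0

/-- `F` is a Lie foliation with Lie algebra `𝔤`: it is defined by a smooth 1-form `η` on `M` with
values in `𝔤` (a Fedida form), which is onto `𝔤` at each point, satisfies the Maurer-Cartan
equation, and has the tangent spaces of `F` as kernels. -/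
def Foliation.IsLie {q : ℕ} (F : Foliation E M q) (𝔤 : Type*) [LieRing 𝔤] [LieAlgebra ℝ 𝔤] :
    Prop :=
  ∃ η : ∀ x : M, TangentSpace 𝓘(ℝ, E) x →ₗ[ℝ] 𝔤,
    IsSmoothForm η ∧ MaurerCartan η ∧
      ∀ x : M, Function.Surjective (η x) ∧ LinearMap.ker (η x) = F.tangent x

end LieAlgebraValued

namespace Foliation

variable {q q' : ℕ}

/-- A (global, smooth) vector field `Z` is foliated for `F` if `[Z, X]` is tangent to `F` for each
smooth vector field `X` tangent to `F`. -/
def IsFoliated (F : Foliation E M q) (Z : ∀ x : M, TangentSpace 𝓘(ℝ, E) x) : Prop :=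
  IsSmoothField Z ∧ ∀ X : ∀ x : M, TangentSpace 𝓘(ℝ, E) x, IsSmoothField X →
    (∀ x, X x ∈ F.tangent x) → ∀ x, VectorField.mlieBracket 𝓘(ℝ, E) Z X x ∈ F.tangent x

/-- The fibre at `x` of the normal bundle `TM / TF`. -/
abbrev Normal (F : Foliation E M q) (x : M) : Type _ :=
  TangentSpace 𝓘(ℝ, E) x ⧸ F.tangent x

/-- A global transverse foliated field: the section of the normal bundle that is induced by a
global foliated vector field. -/
def IsTransverseFoliated (F : Foliation E M q) (σ : ∀ x : M, F.Normal x) : Prop :=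
  ∃ Z : ∀ x : M, TangentSpace 𝓘(ℝ, E) x, F.IsFoliated Z ∧ ∀ x, σ x = (F.tangent x).mkQ (Z x)

/-- The section `σ` of the normal bundle of `F` is tangent to `F'` at `x`: its value lies in the
image of `T_x F'` in `T_x M / T_x F`. -/
def TangentAt (F : Foliation E M q) (F' : Foliation E M q') (σ : ∀ x : M, F.Normal x) (x : M) :
    Prop :=
  σ x ∈ (F'.tangent x).map (F.tangent x).mkQ

end Foliation

end LieFoliation

end

/-! Let `Z` be foliated for `F`, let `TF ⊆ TF'`, and let `f'` be a local submersion defining `F'`.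
Then `Z` is tangent to `F'` exactly where `df'(Z) = 0`. If `X` is tangent to `F`, then `df'(X) = 0`
and `[Z, X]` is tangent to `F`, so `X · df'(Z) = df'([X, Z]) = 0`. Hence `df'(Z)` is locally
constant along the fibres of the submersions defining `F`, and tangency of `Z` to `F'` propagates
along plaques, then along leaves (`IsFoliated.mem_tangent_iff_of_mem_leaf`). The tangency set is
also closed, so once it contains a point it contains the closure of a dense leaf, which is `M`. This
is `IsFoliated.mem_tangent_of_isMinimal`. Taking `F' = F` gives the first claim, an extension `F'`
the second. -/

namespace LieFoliation
open Filter Set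
open scoped Topology

/-! ### Functions constant along the fibres of a submersion between vector spaces. -/

section Local

variable {E : Type*} [NormedAddCommGroup E] [NormedSpace ℝ E] [FiniteDimensional ℝ E]
  {G : Type*} [NormedAddCommGroup G] [NormedSpace ℝ G] [FiniteDimensional ℝ G]
  {H : Type*} [NormedAddCommGroup H] [NormedSpace ℝ H]

/-- A function whose differential vanishes on the kernel of the differential of a submersion is
locally constant on the fibres of the submersion. -/
theorem eventually_eq_of_fderiv_ker {f : E → G} {h : E → H} {a : E}
    (hf : ContDiffAt ℝ 1 f a) (hsurj : Function.Surjective (fderiv ℝ f a))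
    (hh : ∀ᶠ y in 𝓝 a, DifferentiableAt ℝ h y)
    (hker : ∀ᶠ y in 𝓝 a, ∀ v, fderiv ℝ f y v = 0 → fderiv ℝ h y v = 0) :
    ∃ V ∈ 𝓝 a, ∀ y ∈ V, ∀ z ∈ V, f y = f z → h y = h z := by
  set L := fderiv ℝ f a with hL
  -- With `p` a projection onto `ker L`, the map `(f, p)` is a local diffeomorphism at `a` that
  -- straightens the fibres of `f` into slices `{c} × ker L`.
  obtain ⟨p, hp⟩ := L.ker_closedComplemented_of_finiteDimensional_range
  have hpr : p.range = ⊤ := LinearMap.range_eq_top.2 fun k => ⟨k, hp k⟩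
  have hcompl : IsCompl L.ker p.ker := LinearMap.isCompl_of_proj hp
  let e : E ≃L[ℝ] G × L.ker :=
    L.equivProdOfSurjectiveOfIsCompl p (LinearMap.range_eq_top.2 hsurj) hpr hcompl
  let Φ : E → G × L.ker := fun y => (f y, p y)
  have hΦ : ContDiffAt ℝ 1 Φ a := hf.prodMk p.contDiff.contDiffAt
  have hΦ' : HasFDerivAt Φ (e : E →L[ℝ] G × L.ker) a :=
    (hf.differentiableAt one_ne_zero).hasFDerivAt.prodMk p.hasFDerivAt
  let φ := hΦ.toOpenPartialHomeomorph Φ hΦ' one_ne_zero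
  have hφ : ∀ y, φ y = Φ y := fun y => rfl
  have ha : a ∈ φ.source := hΦ.mem_toOpenPartialHomeomorph_source hΦ' one_ne_zero
  have hat : φ a ∈ φ.target := φ.map_source ha
  have hsymm : ContDiffAt ℝ 1 φ.symm (φ a) := hΦ.to_localInverse hΦ' one_ne_zero
  have hsymm_diff : ∀ᶠ w in 𝓝 (φ a), DifferentiableAt ℝ φ.symm w :=
    (hsymm.eventually (by simp)).mono fun w hw => hw.differentiableAt one_ne_zero
  have hf_diff : ∀ᶠ y in 𝓝 a, DifferentiableAt ℝ f y :=
    (hf.eventually (by simp)).mono fun w hw => hw.differentiableAt one_ne_zero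
  have hlim : Tendsto φ.symm (𝓝 (φ a)) (𝓝 a) := by
    simpa [φ.left_inv ha] using (φ.continuousAt_symm hat).tendsto
  -- A ball is convex: the segment joining the images of two points of one fibre stays in it, and
  -- `h` can be differentiated along that segment.
  obtain ⟨r, hr, hball⟩ := Metric.eventually_nhds_iff_ball.1
    (hsymm_diff.and ((hlim.eventually (hf_diff.and (hh.and hker))).and
      (φ.open_target.mem_nhds hat)))
  refine ⟨φ.source ∩ φ ⁻¹' Metric.ball (φ a) r, inter_mem (φ.open_source.mem_nhds ha)
    ((φ.continuousAt ha).preimage_mem_nhds (Metric.ball_mem_nhds _ hr)), ?_⟩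
  rintro y ⟨hy, hyb⟩ z ⟨hz, hzb⟩ hyz
  let γ : ℝ → G × L.ker := AffineMap.lineMap (φ y) (φ z)
  have hγ : ∀ t ∈ Icc (0 : ℝ) 1, γ t ∈ Metric.ball (φ a) r := fun t ht =>
    (convex_ball _ _).lineMap_mem hyb hzb ht
  have hγ' : ∀ t, HasDerivAt γ (φ z - φ y) t := fun t => AffineMap.hasDerivAt_lineMap
  have hderiv : ∀ t ∈ Icc (0 : ℝ) 1, HasDerivAt (fun t => h (φ.symm (γ t))) 0 t := by
    intro t ht
    obtain ⟨h1, ⟨h2, h3, h4⟩, h5⟩ := hball _ (hγ t ht)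
    have hs := h1.hasFDerivAt.comp_hasDerivAt t (hγ' t)
    have hc := h3.hasFDerivAt.comp_hasDerivAt t hs
    rw [h4] at hc
    · exact hc
    -- In the straightened coordinates `f` is the first projection, and `φ z - φ y` has first
    -- component `f z - f y = 0`.
    have hfs : HasFDerivAt (f ∘ φ.symm) (ContinuousLinearMap.fst ℝ G L.ker) (γ t) := by
      refine (ContinuousLinearMap.fst ℝ G L.ker).hasFDerivAt.congr_of_eventuallyEq ?_
      filter_upwards [φ.open_target.mem_nhds h5] with w hw
      exact congrArg Prod.fst (φ.right_inv hw)
    have hfs' := h2.hasFDerivAt.comp (γ t) h1.hasFDerivAt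
    have := congrArg (fun T => T (φ z - φ y)) (hfs'.unique hfs)
    refine this.trans ?_
    simp [hφ, Φ, hyz]
  have hconst := constant_of_has_deriv_right_zero
    (fun t ht => (hderiv t ht).continuousAt.continuousWithinAt)
    (fun t ht => (hderiv t (Ico_subset_Icc_self ht)).hasDerivWithinAt) 1 (by simp)
  simpa [γ, φ.left_inv hy, φ.left_inv hz] using hconst.symm

end Local

/-! ### Vector fields tangent to the fibres of a submersion, in a vector space. -/

section VectorFields

variable {E : Type*} [NormedAddCommGroup E] [NormedSpace ℝ E]
  {G : Type*} [NormedAddCommGroup G] [NormedSpace ℝ G]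

/-- A vector in the kernel of the differential of a submersion extends to a smooth local vector
field tangent to the fibres. -/
theorem exists_vectorField_tangent_fibres [FiniteDimensional ℝ G] {f : E → G} {a : E} (hf : ∀ᶠ y in 𝓝 a, ContDiffAt ℝ ∞ f y)
    (hsurj : Function.Surjective (fderiv ℝ f a)) {v : E} (hv : fderiv ℝ f a v = 0) :
    ∃ X : E → E, (∀ᶠ y in 𝓝 a, ContDiffAt ℝ ∞ X y) ∧ X a = v ∧ ∀ᶠ y in 𝓝 a, fderiv ℝ f y (X y) = 0 := by
  obtain ⟨S, hS⟩ := (fderiv ℝ f a).exists_rightInverse_of_surjective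
    (LinearMap.range_eq_top.2 hsurj)
  -- `B a` is the identity, so `B y` is invertible near `a`; subtracting `S (B y)⁻¹ df_y(v)` from
  -- the constant field `v` moves it into `ker df_y`.
  let B : E → G →L[ℝ] G := fun y => (fderiv ℝ f y).comp S
  have hd : ∀ᶠ y in 𝓝 a, ContDiffAt ℝ ∞ (fderiv ℝ f) y :=
    hf.mono fun y hy => hy.fderiv_right (by simp)
  have hB : ContDiffAt ℝ ∞ B a := hd.self_of_nhds.clm_comp contDiffAt_const
  have hinv : ∀ᶠ y in 𝓝 a, (B y).IsInvertible := hB.continuousAt.eventually (by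
    have hBa : B a = ContinuousLinearEquiv.refl ℝ G := hS
    rw [hBa]
    exact (ContinuousLinearEquiv.refl ℝ G).nhds)
  refine ⟨fun y => v - S ((B y).inverse (fderiv ℝ f y v)), ?_, by simp [hv], ?_⟩
  · filter_upwards [hd, hinv] with y hy hiy
    have hBy : ContDiffAt ℝ ∞ B y := hy.clm_comp contDiffAt_const
    exact contDiffAt_const.sub (S.contDiff.contDiffAt.comp y
      ((hiy.contDiffAt_map_inverse.comp y hBy).clm_apply (hy.clm_apply contDiffAt_const)))
  · filter_upwards [hinv] with y hy
    have h1 : B y ((B y).inverse (fderiv ℝ f y v)) = fderiv ℝ f y v := hy.self_apply_inverse _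
    rw [map_sub, sub_eq_zero]
    exact h1.symm

/-- If `dg(X) = 0` near `a`, then `X · dg(Z) = dg([X, Z])` at `a`. -/
theorem fderiv_fderiv_apply_of_tangent {g : E → G} {Z X : E → E} {a : E}
    (hg : ContDiffAt ℝ 2 g a) (hZ : DifferentiableAt ℝ Z a) (hX : DifferentiableAt ℝ X a)
    (hgX : ∀ᶠ y in 𝓝 a, fderiv ℝ g y (X y) = 0)
    (hbr : fderiv ℝ g a (VectorField.lieBracket ℝ Z X a) = 0) :
    fderiv ℝ (fun y => fderiv ℝ g y (Z y)) a (X a) = 0 := by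
  have hd : DifferentiableAt ℝ (fderiv ℝ g) a :=
    (hg.fderiv_right (m := 1) (by norm_num)).differentiableAt one_ne_zero
  have h1 := (hd.hasFDerivAt.clm_apply hX.hasFDerivAt).fderiv
  have h0 : fderiv ℝ (fun y => fderiv ℝ g y (X y)) a = 0 := by
    rw [Filter.EventuallyEq.fderiv_eq (f := fun _ => (0 : G)) hgX]; simp
  -- Differentiating `dg(X) = 0` along `Z` gives `D²g(Z, X) + dg(DX·Z) = 0`. Symmetry of `D²g` and
  -- `dg(DX·Z) = dg(DZ·X)`, which is `hbr`, turn this into the claim.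
  have h2 := congrArg (fun T => T (Z a)) (h0.symm.trans h1)
  have hsymm : IsSymmSndFDerivAt ℝ g a := hg.isSymmSndFDerivAt (by simp)
  rw [(hd.hasFDerivAt.clm_apply hZ.hasFDerivAt).fderiv]
  simp only [zero_apply, add_apply,
    ContinuousLinearMap.comp_apply, ContinuousLinearMap.flip_apply] at h2 ⊢
  rw [VectorField.lieBracket, map_sub, sub_eq_zero] at hbr
  rw [← hbr, hsymm.eq, ← h2]

end VectorFields

/-! ### Reading maps and vector fields in a chart, and globalising local fields. -/

section Chart

variable {E : Type*} [NormedAddCommGroup E] [NormedSpace ℝ E]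
  {M : Type*} [TopologicalSpace M] [ChartedSpace E M] [IsManifold 𝓘(ℝ, E) ∞ M]
  {G : Type*} [NormedAddCommGroup G] [NormedSpace ℝ G]

theorem contDiffAt_comp_extChartAt_symm {n : WithTop ℕ∞} (hn : n ≤ ∞) {f : M → G} {x y : M}
    (hy : y ∈ (extChartAt 𝓘(ℝ, E) x).source) (hf : ContMDiffAt 𝓘(ℝ, E) 𝓘(ℝ, G) n f y) :
    ContDiffAt ℝ n (f ∘ (extChartAt 𝓘(ℝ, E) x).symm) (extChartAt 𝓘(ℝ, E) x y) := by
  have : IsManifold 𝓘(ℝ, E) n M := .of_le hn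
  refine (ContMDiffAt.comp _ (I' := 𝓘(ℝ, E)) ?_ ?_).contDiffAt
  · rwa [(extChartAt 𝓘(ℝ, E) x).left_inv hy]
  · have := (contMDiffOn_extChartAt_symm (I := 𝓘(ℝ, E)) (n := n) x) _
      ((extChartAt 𝓘(ℝ, E) x).map_source hy)
    exact this.contMDiffAt ((isOpen_extChartAt_target x).mem_nhds
      ((extChartAt 𝓘(ℝ, E) x).map_source hy))

theorem mdifferentiableAt_extChartAt_symm {x y : M} (hy : y ∈ (extChartAt 𝓘(ℝ, E) x).source) :
    MDifferentiableAt 𝓘(ℝ, E) 𝓘(ℝ, E) (extChartAt 𝓘(ℝ, E) x).symm (extChartAt 𝓘(ℝ, E) x y) := by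
  have : IsManifold 𝓘(ℝ, E) 1 M := .of_le (n := ∞) (by simp)
  have := mdifferentiableWithinAt_extChartAt_symm (I := 𝓘(ℝ, E))
      ((extChartAt 𝓘(ℝ, E) x).map_source hy)
  rwa [ModelWithCorners.range_eq_univ, mdifferentiableWithinAt_univ] at this

/-- The differential of a map read in a chart. -/
theorem mfderiv_eq_fderiv_comp_extChartAt {f : M → G} {x y : M}
    (hy : y ∈ (extChartAt 𝓘(ℝ, E) x).source) (hf : MDifferentiableAt 𝓘(ℝ, E) 𝓘(ℝ, G) f y)
    (v : TangentSpace 𝓘(ℝ, E) y) :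
    (mfderiv 𝓘(ℝ, E) 𝓘(ℝ, G) f y v : G) =
      fderiv ℝ (f ∘ (extChartAt 𝓘(ℝ, E) x).symm) (extChartAt 𝓘(ℝ, E) x y)
        (mfderiv 𝓘(ℝ, E) 𝓘(ℝ, E) (extChartAt 𝓘(ℝ, E) x) y v) := by
  have : IsManifold 𝓘(ℝ, E) 1 M := .of_le (n := ∞) (by simp)
  have h1 : MDifferentiableAt 𝓘(ℝ, E) 𝓘(ℝ, E) (extChartAt 𝓘(ℝ, E) x) y :=
    mdifferentiableAt_extChartAt (by simpa using hy)
  have h2 : MDifferentiableAt 𝓘(ℝ, E) 𝓘(ℝ, G) (f ∘ (extChartAt 𝓘(ℝ, E) x).symm)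
      (extChartAt 𝓘(ℝ, E) x y) := by
    refine MDifferentiableAt.comp _ (I' := 𝓘(ℝ, E)) ?_ (mdifferentiableAt_extChartAt_symm hy)
    rwa [(extChartAt 𝓘(ℝ, E) x).left_inv hy]
  have h3 : f =ᶠ[𝓝 y] (f ∘ (extChartAt 𝓘(ℝ, E) x).symm) ∘ extChartAt 𝓘(ℝ, E) x := by
    filter_upwards [(isOpen_extChartAt_source x).mem_nhds hy] with z hz
    exact congrArg f ((extChartAt 𝓘(ℝ, E) x).left_inv hz).symm
  have h4 := h3.mfderiv_eq (I := 𝓘(ℝ, E)) (I' := 𝓘(ℝ, G))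
  rw [mfderiv_comp y h2 h1, mfderiv_eq_fderiv] at h4
  exact congrArg (fun T : E →L[ℝ] G => T v) h4

theorem mfderiv_extChartAt_surjective {x y : M} (hy : y ∈ (extChartAt 𝓘(ℝ, E) x).source) :
    Function.Surjective (mfderiv 𝓘(ℝ, E) 𝓘(ℝ, E) (extChartAt 𝓘(ℝ, E) x) y) := by
  have : IsManifold 𝓘(ℝ, E) 1 M := .of_le (n := ∞) (by simp)
  exact fun v => ⟨_, (isInvertible_mfderiv_extChartAt hy).self_apply_inverse v⟩

/-- The vector field `Z` read in the chart at `x`. -/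
noncomputable def chartField (x : M) (Z : ∀ x : M, TangentSpace 𝓘(ℝ, E) x) : E → E :=
  VectorField.mpullbackWithin 𝓘(ℝ, E) 𝓘(ℝ, E) (extChartAt 𝓘(ℝ, E) x).symm Z (range 𝓘(ℝ, E))

theorem mfderiv_extChartAt_apply_field (Z : ∀ x : M, TangentSpace 𝓘(ℝ, E) x) {x y : M}
    (hy : y ∈ (extChartAt 𝓘(ℝ, E) x).source) :
    (mfderiv 𝓘(ℝ, E) 𝓘(ℝ, E) (extChartAt 𝓘(ℝ, E) x) y (Z y) : E) =
      chartField x Z (extChartAt 𝓘(ℝ, E) x y) := by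
  have : IsManifold 𝓘(ℝ, E) 1 M := .of_le (n := ∞) (by simp)
  have hA : (extChartAt 𝓘(ℝ, E) x).symm (extChartAt 𝓘(ℝ, E) x y) = y :=
    (extChartAt 𝓘(ℝ, E) x).left_inv hy
  have hy' := (extChartAt 𝓘(ℝ, E) x).map_source hy
  have h2 := isInvertible_mfderivWithin_extChartAt_symm (I := 𝓘(ℝ, E)) hy'
  have h3 := mfderivWithin_extChartAt_symm_comp_mfderiv_extChartAt (I := 𝓘(ℝ, E)) hy'
  have h4 := congrArg (fun T => T (Z ((extChartAt 𝓘(ℝ, E) x).symm (extChartAt 𝓘(ℝ, E) x y)))) h3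
  have h5 := (h2.inverse_apply_eq.2 h4.symm).symm
  simp only [ContinuousLinearMap.id_apply] at h5
  rw [chartField, VectorField.mpullbackWithin_apply]
  rw [hA] at h5 ⊢
  exact h5

variable [CompleteSpace E]

theorem contDiffAt_chartField {x : M} {Z : ∀ x : M, TangentSpace 𝓘(ℝ, E) x}
    (hZ : ContMDiffAt 𝓘(ℝ, E) 𝓘(ℝ, E).tangent ∞
      (fun x => (⟨x, Z x⟩ : TangentBundle 𝓘(ℝ, E) M)) x) :
    ContDiffAt ℝ ∞ (chartField x Z) (extChartAt 𝓘(ℝ, E) x x) := by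
  have : IsManifold 𝓘(ℝ, E) 1 M := .of_le (n := ∞) (by simp)
  have : IsManifold 𝓘(ℝ, E) (∞ + 1) M := by simpa
  have h := VectorField.contMDiffWithinAt_mpullbackWithin_extChartAt_symm (n := ∞) (m := ∞)
    hZ.contMDiffWithinAt (s := univ) uniqueMDiffOn_univ (mem_univ x) (by simp)
  rw [contMDiffWithinAt_vectorSpace_iff_contDiffWithinAt] at h
  exact h.contDiffAt (by simpa using extChartAt_target_mem_nhds (I := 𝓘(ℝ, E)) x)

variable [T2Space M] [FiniteDimensional ℝ E]

/-- A local smooth vector field given in a chart extends, after multiplication by a bump function,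
to a global smooth vector field. -/
theorem exists_isSmoothField_chart (x : M) {X : E → E}
    (hX : ∀ᶠ e in 𝓝 (extChartAt 𝓘(ℝ, E) x x), ContDiffAt ℝ ∞ X e) {s : Set M} (hs : s ∈ 𝓝 x) :
    ∃ (Y : ∀ x : M, TangentSpace 𝓘(ℝ, E) x) (c : M → ℝ), IsSmoothField Y ∧
      (∀ᶠ y in 𝓝 x, c y = 1) ∧ (∀ y ∉ s, Y y = 0) ∧
      ∀ y ∈ (extChartAt 𝓘(ℝ, E) x).source,
        (mfderiv 𝓘(ℝ, E) 𝓘(ℝ, E) (extChartAt 𝓘(ℝ, E) x) y (Y y) : E) =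
        c y • X (extChartAt 𝓘(ℝ, E) x y) := by
  have : IsManifold 𝓘(ℝ, E) 1 M := .of_le (n := ∞) (by simp)
  obtain ⟨u, hu, huo, hxu⟩ := mem_nhds_iff.1 (inter_mem hs
    (inter_mem (extChartAt_source_mem_nhds (I := 𝓘(ℝ, E)) x)
      ((continuousAt_extChartAt (I := 𝓘(ℝ, E)) x).eventually hX)))
  -- The closed support of `c` lies in `u`, where the pulled-back field is smooth, so the product
  -- with `c` is smooth on all of `M`.
  obtain ⟨c, -, hc⟩ := (SmoothBumpFunction.nhds_basis_tsupport (I := 𝓘(ℝ, E)) x).mem_iff.1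
    (huo.mem_nhds hxu)
  let Y₀ : ∀ x : M, TangentSpace 𝓘(ℝ, E) x :=
    VectorField.mpullback 𝓘(ℝ, E) 𝓘(ℝ, E) (extChartAt 𝓘(ℝ, E) x) X
  have hY₀ : ContMDiffOn 𝓘(ℝ, E) 𝓘(ℝ, E).tangent ∞
      (fun x => (⟨x, Y₀ x⟩ : TangentBundle 𝓘(ℝ, E) M)) u := fun y hy => by
    refine ContMDiffAt.contMDiffWithinAt ?_
    refine ContMDiffAt.mpullback_vectorField_preimage (n := ∞) ?_
      (contMDiffAt_extChartAt' (by simpa using (hu hy).2.1))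
      (isInvertible_mfderiv_extChartAt (hu hy).2.1) (by simp)
    exact contMDiffAt_vectorSpace_iff_contDiffAt.2 (hu hy).2.2
  refine ⟨(c : M → ℝ) • Y₀, c, ?_, c.eventuallyEq_one, ?_, ?_⟩
  · exact ContMDiffOn.smul_section_of_tsupport c.contMDiff.contMDiffOn huo hc hY₀
  · intro y hy
    have : c y = 0 := image_eq_zero_of_notMem_tsupport fun h => hy (hu (hc h)).1
    simp [this]
  · intro y hy
    have h1 := (isInvertible_mfderiv_extChartAt (I := 𝓘(ℝ, E)) hy).self_apply_inverse
      (X (extChartAt 𝓘(ℝ, E) x y))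
    have h2 := (mfderiv 𝓘(ℝ, E) 𝓘(ℝ, E) (extChartAt 𝓘(ℝ, E) x) y).map_smul (c y) (Y₀ y)
    exact h2.trans (congrArg (fun w : E => c y • w) h1)

end Chart

/-! ### Submersions defining a foliation. -/

section Distinguished

variable {E : Type*} [NormedAddCommGroup E] [NormedSpace ℝ E]
  {M : Type*} [TopologicalSpace M] [ChartedSpace E M] {q : ℕ}
  {D : ∀ x : M, Submodule ℝ (TangentSpace 𝓘(ℝ, E) x)} {U : Set M}
  {f : M → EuclideanSpace ℝ (Fin q)}

/-- The derivative of `f` along the vector field `Z`. -/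
noncomputable def derivAlong (f : M → EuclideanSpace ℝ (Fin q))
    (Z : ∀ x : M, TangentSpace 𝓘(ℝ, E) x) (y : M) : EuclideanSpace ℝ (Fin q) :=
  mfderiv 𝓘(ℝ, E) 𝓘(ℝ, EuclideanSpace ℝ (Fin q)) f y (Z y)

namespace IsDistinguished

theorem contMDiffAt (hf : IsDistinguished D U f) {y : M} (hy : y ∈ U) :
    ContMDiffAt 𝓘(ℝ, E) 𝓘(ℝ, EuclideanSpace ℝ (Fin q)) ∞ f y :=
  hf.contMDiffOn.contMDiffAt (hf.isOpen.mem_nhds hy)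

theorem mdifferentiableAt (hf : IsDistinguished D U f) {y : M} (hy : y ∈ U) :
    MDifferentiableAt 𝓘(ℝ, E) 𝓘(ℝ, EuclideanSpace ℝ (Fin q)) f y :=
  (hf.contMDiffAt hy).mdifferentiableAt (by simp)

theorem derivAlong_eq_zero_iff (hf : IsDistinguished D U f)
    (Z : ∀ x : M, TangentSpace 𝓘(ℝ, E) x) {y : M} (hy : y ∈ U) :
    derivAlong f Z y = 0 ↔ Z y ∈ D y :=
  hf.ker_eq y hy (Z y)

variable [IsManifold 𝓘(ℝ, E) ∞ M]

theorem mem_iff_fderiv_chart (hf : IsDistinguished D U f) {x y : M} (hy : y ∈ U)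
    (hyx : y ∈ (extChartAt 𝓘(ℝ, E) x).source) (v : TangentSpace 𝓘(ℝ, E) y) :
    v ∈ D y ↔ fderiv ℝ (f ∘ (extChartAt 𝓘(ℝ, E) x).symm) (extChartAt 𝓘(ℝ, E) x y)
        (mfderiv 𝓘(ℝ, E) 𝓘(ℝ, E) (extChartAt 𝓘(ℝ, E) x) y v) = 0 := by
  rw [← mfderiv_eq_fderiv_comp_extChartAt hyx (hf.mdifferentiableAt hy)]
  exact (hf.ker_eq y hy v).symm

theorem surjective_fderiv_chart (hf : IsDistinguished D U f) {x y : M} (hy : y ∈ U)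
    (hyx : y ∈ (extChartAt 𝓘(ℝ, E) x).source) :
    Function.Surjective
      (fderiv ℝ (f ∘ (extChartAt 𝓘(ℝ, E) x).symm) (extChartAt 𝓘(ℝ, E) x y)) := fun w => by
  obtain ⟨v, hv⟩ := hf.surjective y hy w
  exact ⟨_, (mfderiv_eq_fderiv_comp_extChartAt hyx (hf.mdifferentiableAt hy) v).symm.trans hv⟩

/-- The derivative is the fibre component of the tangent map of `f` composed with the section `Z`.
The tangent map is taken within `U`, since `f` is only controlled there. -/
theorem contMDiffAt_derivAlong (hf : IsDistinguished D U f)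
    {Z : ∀ x : M, TangentSpace 𝓘(ℝ, E) x} (hZ : IsSmoothField Z) {y : M} (hy : y ∈ U) :
    ContMDiffAt 𝓘(ℝ, E) 𝓘(ℝ, EuclideanSpace ℝ (Fin q)) ∞ (derivAlong f Z) y := by
  have : IsManifold 𝓘(ℝ, E) 1 M := .of_le (n := ∞) (by simp)
  have h1 := hf.contMDiffOn.contMDiffOn_tangentMapWithin (m := ∞) (by simp)
    hf.isOpen.uniqueMDiffOn
  have h2 : ContMDiffOn 𝓘(ℝ, E) 𝓘(ℝ, EuclideanSpace ℝ (Fin q)) ∞ (fun y =>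
      (tangentMapWithin 𝓘(ℝ, E) 𝓘(ℝ, EuclideanSpace ℝ (Fin q)) f U ⟨y, Z y⟩).2) U :=
    (contMDiff_snd_tangentBundle_modelSpace _ _).comp_contMDiffOn
      (h1.comp hZ.contMDiffOn fun y hy => hy)
  refine (h2.congr fun z hz => ?_).contMDiffAt (hf.isOpen.mem_nhds hy)
  simp only [tangentMapWithin, mfderivWithin_of_isOpen hf.isOpen hz]
  rfl

end IsDistinguished

end Distinguished

/-! ### Tangency of a foliated field: closedness, and invariance along leaves. -/

namespace Foliation

section Closed

variable {E : Type*} [NormedAddCommGroup E] [NormedSpace ℝ E]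
  {M : Type*} [TopologicalSpace M] [ChartedSpace E M] [IsManifold 𝓘(ℝ, E) ∞ M]
  {q' : ℕ} {Z : ∀ x : M, TangentSpace 𝓘(ℝ, E) x}

/-- The set of points where a smooth field is tangent to a foliation is closed. -/
theorem isClosed_setOf_mem_tangent (F' : Foliation E M q') (hZ : IsSmoothField Z) :
    IsClosed {x | Z x ∈ F'.tangent x} := by
  rw [isClosed_iff_frequently]
  intro x hx
  obtain ⟨U, f, hxU, hf⟩ := F'.exists_distinguished x
  by_contra hne
  have h1 : derivAlong f Z x ≠ 0 := fun h => hne ((hf.derivAlong_eq_zero_iff Z hxU).1 h)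
  refine hx ?_
  filter_upwards [(hf.contMDiffAt_derivAlong hZ hxU).continuousAt.eventually_ne h1,
    hf.isOpen.mem_nhds hxU] with y hy hyU hyZ
  exact hy ((hf.derivAlong_eq_zero_iff Z hyU).2 hyZ)

end Closed

variable {E : Type*} [NormedAddCommGroup E] [NormedSpace ℝ E] [FiniteDimensional ℝ E]
  {M : Type*} [TopologicalSpace M] [ChartedSpace E M] [IsManifold 𝓘(ℝ, E) ∞ M] [T2Space M]
  {q q' : ℕ} {F : Foliation E M q} {F' : Foliation E M q'}
  {Z : ∀ x : M, TangentSpace 𝓘(ℝ, E) x}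

/-- A vector tangent to a foliation extends to a global smooth vector field tangent to it. -/
theorem exists_tangent_field (F : Foliation E M q) (x : M) {v : TangentSpace 𝓘(ℝ, E) x}
    (hv : v ∈ F.tangent x) :
    ∃ X : ∀ x : M, TangentSpace 𝓘(ℝ, E) x,
      IsSmoothField X ∧ (∀ y, X y ∈ F.tangent y) ∧ X x = v := by
  have : IsManifold 𝓘(ℝ, E) 1 M := .of_le (n := ∞) (by simp)
  obtain ⟨U, f, hxU, hf⟩ := F.exists_distinguished x
  have hU := hf.isOpen.mem_nhds hxU
  have hx := mem_extChartAt_source (I := 𝓘(ℝ, E)) x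
  have hcd : ∀ᶠ e in 𝓝 (extChartAt 𝓘(ℝ, E) x x),
      ContDiffAt ℝ ∞ (f ∘ (extChartAt 𝓘(ℝ, E) x).symm) e := by
    have h1 := (continuousAt_extChartAt_symm (I := 𝓘(ℝ, E)) x).preimage_mem_nhds
      (by simpa using hU)
    filter_upwards [h1, extChartAt_target_mem_nhds (I := 𝓘(ℝ, E)) x] with e he het
    have := contDiffAt_comp_extChartAt_symm le_rfl ((extChartAt 𝓘(ℝ, E) x).map_target het)
      (hf.contMDiffAt he)
    rwa [(extChartAt 𝓘(ℝ, E) x).right_inv het] at this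
  obtain ⟨X, hX, hXv, hXf⟩ := exists_vectorField_tangent_fibres hcd
    (hf.surjective_fderiv_chart hxU hx) ((hf.mem_iff_fderiv_chart hxU hx v).1 hv)
  have hs : ∀ᶠ y in 𝓝 x, y ∈ U ∧ y ∈ (extChartAt 𝓘(ℝ, E) x).source ∧
      fderiv ℝ (f ∘ (extChartAt 𝓘(ℝ, E) x).symm) (extChartAt 𝓘(ℝ, E) x y)
        (X (extChartAt 𝓘(ℝ, E) x y)) = 0 :=
    (eventually_mem_set.2 hU).and ((eventually_mem_set.2 (extChartAt_source_mem_nhds x)).and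
      ((continuousAt_extChartAt x).eventually hXf))
  obtain ⟨Y, c, hY, hc1, hY0, hYc⟩ := exists_isSmoothField_chart x hX hs
  refine ⟨Y, hY, fun y => ?_, ?_⟩
  · by_cases hy : y ∈ {y | y ∈ U ∧ y ∈ (extChartAt 𝓘(ℝ, E) x).source ∧
      fderiv ℝ (f ∘ (extChartAt 𝓘(ℝ, E) x).symm) (extChartAt 𝓘(ℝ, E) x y)
        (X (extChartAt 𝓘(ℝ, E) x y)) = 0}
    · obtain ⟨h1, h2, h3⟩ := hy
      rw [hf.mem_iff_fderiv_chart h1 h2]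
      refine (congrArg _ (hYc y h2)).trans ?_
      rw [map_smul, h3, smul_zero]
    · rw [hY0 y hy]
      exact zero_mem _
  · have h1 := hYc x hx
    rw [hc1.self_of_nhds, one_smul, hXv] at h1
    have hi := isInvertible_mfderiv_extChartAt hx
    have h2 := congrArg
      (mfderiv 𝓘(ℝ, E) 𝓘(ℝ, E) (extChartAt 𝓘(ℝ, E) x) x).inverse h1
    exact (hi.inverse_apply_self _).symm.trans (h2.trans (hi.inverse_apply_self v))

/-- If `Z` is foliated for `F` and `F ⊆ F'`, then `df'(Z)` is constant along `F`, for each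
submersion `f'` defining `F'`. -/
theorem IsFoliated.mfderiv_derivAlong_eq_zero (hZ : F.IsFoliated Z)
    (hle : ∀ x, F.tangent x ≤ F'.tangent x) {U : Set M} {f : M → EuclideanSpace ℝ (Fin q')}
    (hf : IsDistinguished F'.tangent U f) {x : M} (hx : x ∈ U) {v : TangentSpace 𝓘(ℝ, E) x}
    (hv : v ∈ F.tangent x) :
    (mfderiv 𝓘(ℝ, E) 𝓘(ℝ, EuclideanSpace ℝ (Fin q')) (derivAlong f Z) x v :
      EuclideanSpace ℝ (Fin q')) = 0 := by
  have : IsManifold 𝓘(ℝ, E) 1 M := .of_le (n := ∞) (by simp)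
  obtain ⟨X, hX, hXF, hXv⟩ := F.exists_tangent_field x hv
  have hxs := mem_extChartAt_source (I := 𝓘(ℝ, E)) x
  have hnear : ∀ᶠ e in 𝓝 (extChartAt 𝓘(ℝ, E) x x), e ∈ (extChartAt 𝓘(ℝ, E) x).target ∧
      (extChartAt 𝓘(ℝ, E) x).symm e ∈ U := by
    have h1 := (continuousAt_extChartAt_symm (I := 𝓘(ℝ, E)) x).preimage_mem_nhds
      (by simpa using hf.isOpen.mem_nhds hx)
    filter_upwards [h1, extChartAt_target_mem_nhds (I := 𝓘(ℝ, E)) x] with e he het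
    exact ⟨het, he⟩
  have hread : ∀ W : ∀ x : M, TangentSpace 𝓘(ℝ, E) x, ∀ᶠ e in 𝓝 (extChartAt 𝓘(ℝ, E) x x),
      (derivAlong f W ∘ (extChartAt 𝓘(ℝ, E) x).symm) e =
        fderiv ℝ (f ∘ (extChartAt 𝓘(ℝ, E) x).symm) e (chartField x W e) := by
    intro W
    filter_upwards [hnear] with e ⟨het, heU⟩
    have hes := (extChartAt 𝓘(ℝ, E) x).map_target het
    have h1 := mfderiv_eq_fderiv_comp_extChartAt hes (hf.mdifferentiableAt heU)
      (W ((extChartAt 𝓘(ℝ, E) x).symm e))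
    have h2 := mfderiv_extChartAt_apply_field W hes
    refine h1.trans ((congrArg _ h2).trans ?_)
    rw [(extChartAt 𝓘(ℝ, E) x).right_inv het]
  have hXtan : ∀ᶠ e in 𝓝 (extChartAt 𝓘(ℝ, E) x x),
      fderiv ℝ (f ∘ (extChartAt 𝓘(ℝ, E) x).symm) e (chartField x X e) = 0 := by
    filter_upwards [hnear, hread X] with e ⟨het, heU⟩ he
    rw [← he]
    exact (hf.derivAlong_eq_zero_iff X heU).2 (hle _ (hXF _))
  have hbr : fderiv ℝ (f ∘ (extChartAt 𝓘(ℝ, E) x).symm) (extChartAt 𝓘(ℝ, E) x x)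
      (VectorField.lieBracket ℝ (chartField x Z) (chartField x X)
        (extChartAt 𝓘(ℝ, E) x x)) = 0 := by
    have h1 := (hf.mem_iff_fderiv_chart hx hxs _).1 (hle x (hZ.2 X hX hXF x))
    have h2 : (mfderiv 𝓘(ℝ, E) 𝓘(ℝ, E) (extChartAt 𝓘(ℝ, E) x) x
        (VectorField.mlieBracket 𝓘(ℝ, E) Z X x) : E) =
        VectorField.lieBracket ℝ (chartField x Z) (chartField x X)
          (extChartAt 𝓘(ℝ, E) x x) := by
      -- The bracket on `M` is by definition the pullback of the bracket of the fields read in the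
      -- chart, so the differential of the chart sends it back to that bracket.
      rw [← VectorField.mlieBracketWithin_univ, VectorField.mlieBracketWithin_apply]
      refine ((isInvertible_mfderiv_extChartAt hxs).self_apply_inverse _).trans ?_
      change VectorField.lieBracketWithin ℝ (chartField x Z) (chartField x X) _ _ = _
      rw [ModelWithCorners.range_eq_univ, preimage_univ, inter_self,
        VectorField.lieBracketWithin_univ]
    rw [← h2]
    exact h1
  have hmain := fderiv_fderiv_apply_of_tangent
    ((contDiffAt_comp_extChartAt_symm le_rfl hxs (hf.contMDiffAt hx)).of_le
      (WithTop.coe_le_coe.2 (le_top : (2 : ℕ∞) ≤ ⊤)))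
    ((contDiffAt_chartField (hZ.1 x)).differentiableAt (by simp))
    ((contDiffAt_chartField (hX x)).differentiableAt (by simp)) hXtan hbr
  rw [← hXv]
  refine (mfderiv_eq_fderiv_comp_extChartAt hxs
    ((hf.contMDiffAt_derivAlong hZ.1 hx).mdifferentiableAt (by simp)) (X x)).trans ?_
  refine (congrArg (fun w : E => fderiv ℝ (derivAlong f Z ∘ (extChartAt 𝓘(ℝ, E) x).symm)
    (extChartAt 𝓘(ℝ, E) x x) w) (mfderiv_extChartAt_apply_field X hxs)).trans ?_
  rw [Filter.EventuallyEq.fderiv_eq (hread Z)]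
  exact hmain

/-- If `Z` is foliated for `F` and `F ⊆ F'`, tangency of `Z` to `F'` is locally constant along
the fibres of the submersions defining `F`. -/
theorem IsFoliated.eventually_mem_tangent_iff (hZ : F.IsFoliated Z)
    (hle : ∀ x, F.tangent x ≤ F'.tangent x) {U : Set M} {f : M → EuclideanSpace ℝ (Fin q)}
    (hf : IsDistinguished F.tangent U f) {x : M} (hx : x ∈ U) :
    ∀ᶠ y in 𝓝 x, f y = f x → (Z x ∈ F'.tangent x ↔ Z y ∈ F'.tangent y) := by
  obtain ⟨U', f', hxU', hf'⟩ := F'.exists_distinguished x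
  have hxs := mem_extChartAt_source (I := 𝓘(ℝ, E)) x
  set h := derivAlong f' Z with hh
  have hnear : ∀ᶠ e in 𝓝 (extChartAt 𝓘(ℝ, E) x x), e ∈ (extChartAt 𝓘(ℝ, E) x).target ∧
      (extChartAt 𝓘(ℝ, E) x).symm e ∈ U ∩ U' := by
    have h1 := (continuousAt_extChartAt_symm (I := 𝓘(ℝ, E)) x).preimage_mem_nhds
      (by
        rw [extChartAt_to_inv]
        exact inter_mem (hf.isOpen.mem_nhds hx) (hf'.isOpen.mem_nhds hxU'))
    filter_upwards [h1, extChartAt_target_mem_nhds (I := 𝓘(ℝ, E)) x] with e he het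
    exact ⟨het, he⟩
  -- The submersion is the one defining `F`, while the function shown constant on its fibres is
  -- `df'(Z)`, built from a submersion defining `F'`.
  obtain ⟨V, hV, hVc⟩ := eventually_eq_of_fderiv_ker (h := h ∘ (extChartAt 𝓘(ℝ, E) x).symm)
    ((contDiffAt_comp_extChartAt_symm le_rfl hxs (hf.contMDiffAt hx)).of_le (by exact_mod_cast le_top))
    (hf.surjective_fderiv_chart hx hxs)
    (by
      filter_upwards [hnear] with e ⟨het, _, heU'⟩
      have := contDiffAt_comp_extChartAt_symm le_rfl ((extChartAt 𝓘(ℝ, E) x).map_target het)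
        (hf'.contMDiffAt_derivAlong hZ.1 heU')
      rw [(extChartAt 𝓘(ℝ, E) x).right_inv het] at this
      exact this.differentiableAt (by simp))
    (by
      filter_upwards [hnear] with e ⟨het, heU, heU'⟩ w hw
      have hes := (extChartAt 𝓘(ℝ, E) x).map_target het
      obtain ⟨v, rfl⟩ := mfderiv_extChartAt_surjective hes w
      have h1 := mfderiv_eq_fderiv_comp_extChartAt hes
        ((hf'.contMDiffAt_derivAlong hZ.1 heU').mdifferentiableAt (by simp)) v
      have h2 := hf.mem_iff_fderiv_chart heU hes v
      rw [(extChartAt 𝓘(ℝ, E) x).right_inv het] at h1 h2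
      exact h1.symm.trans (hZ.mfderiv_derivAlong_eq_zero hle hf' heU' (h2.2 hw)))
  filter_upwards [(continuousAt_extChartAt (I := 𝓘(ℝ, E)) x).preimage_mem_nhds hV,
    extChartAt_source_mem_nhds (I := 𝓘(ℝ, E)) x, hf'.isOpen.mem_nhds hxU'] with y hyV hys hyU' hfy
  have h1 := hVc _ (mem_of_mem_nhds hV) _ hyV
  simp only [Function.comp_apply, PartialEquiv.left_inv _ hys, PartialEquiv.left_inv _ hxs] at h1
  rw [← hf'.derivAlong_eq_zero_iff Z hxU', ← hf'.derivAlong_eq_zero_iff Z hyU', ← hh,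
    h1 hfy.symm]

/-- Having the same tangency status is an equivalence relation, so it suffices to treat one plaque;
there it holds locally, hence globally by connectedness. -/
theorem IsFoliated.mem_tangent_iff_of_mem_leaf (hZ : F.IsFoliated Z)
    (hle : ∀ x, F.tangent x ≤ F'.tangent x) {x y : M} (hy : y ∈ F.leaf x) :
    Z x ∈ F'.tangent x ↔ Z y ∈ F'.tangent y := by
  induction hy with
  | rel x y hxy =>
    obtain ⟨U, f, C, hf, hCU, hC, hxC, hyC, hfC⟩ := hxy
    refine hC.induction₂ (fun a b => Z a ∈ F'.tangent a ↔ Z b ∈ F'.tangent b) (fun a ha => ?_)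
      (fun _ _ _ _ _ _ => Iff.trans) (fun _ _ _ _ => Iff.symm) hxC hyC
    filter_upwards [self_mem_nhdsWithin,
      mem_nhdsWithin_of_mem_nhds (hZ.eventually_mem_tangent_iff hle hf (hCU ha))] with b hb hab
    exact hab ((hfC b hb).trans (hfC a ha).symm)
  | refl x => exact Iff.rfl
  | symm x y _ h => exact h.symm
  | trans x y z _ _ h₁ h₂ => exact h₁.trans h₂

/-- A foliated field of a minimal foliation `F` that is tangent at one point to a foliation
containing `F` is tangent to it everywhere. -/
theorem IsFoliated.mem_tangent_of_isMinimal (hZ : F.IsFoliated Z) (hmin : F.IsMinimal)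
    (hle : ∀ x, F.tangent x ≤ F'.tangent x) {x₀ : M} (hx₀ : Z x₀ ∈ F'.tangent x₀) (x : M) :
    Z x ∈ F'.tangent x :=
  (F'.isClosed_setOf_mem_tangent hZ.1).closure_subset_iff.2
    (fun _ hy => (hZ.mem_tangent_iff_of_mem_leaf hle hy).1 hx₀) (hmin x₀ x)

theorem mkQ_mem_map_iff {R V : Type*} [Ring R] [AddCommGroup V] [Module R V] {p p' : Submodule R V}
    (h : p ≤ p') (v : V) : p.mkQ v ∈ p'.map p.mkQ ↔ v ∈ p' := by
  rw [← Submodule.mem_comap, Submodule.comap_map_mkQ, sup_eq_right.2 h]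

end Foliation

end LieFoliation

open LieFoliation in
theorem mainTheorem2
    {E : Type*} [NormedAddCommGroup E] [NormedSpace ℝ E] [FiniteDimensional ℝ E]
    {M : Type*} [TopologicalSpace M] [ChartedSpace E M] [IsManifold 𝓘(ℝ, E) ∞ M]
    [T2Space M] [CompactSpace M] [ConnectedSpace M]
    {𝔤 : Type*} [LieRing 𝔤] [LieAlgebra ℝ 𝔤] [FiniteDimensional ℝ 𝔤]
    {q : ℕ} (F : Foliation E M q) (hLie : F.IsLie 𝔤) (hmin : F.IsMinimal) :
    (∀ σ : ∀ x : M, F.Normal x, F.IsTransverseFoliated σ →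
      (∃ x₀ : M, σ x₀ = 0) → ∀ x : M, σ x = 0) ∧
    (∀ (q' : ℕ) (F' : Foliation E M q'), F'.IsExtension F →
      ∀ σ : ∀ x : M, F.Normal x, F.IsTransverseFoliated σ →
        (∃ x₀ : M, F.TangentAt F' σ x₀) → ∀ x : M, F.TangentAt F' σ x) := by
  constructor
  · rintro σ ⟨Z, hZ, hσ⟩ ⟨x₀, hx₀⟩ x
    rw [hσ, Submodule.mkQ_apply, Submodule.Quotient.mk_eq_zero] at hx₀ ⊢
    -- Vanishing in `TM / TF` is tangency to `F` itself, so `F` plays the role of `F'`.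
    exact hZ.mem_tangent_of_isMinimal hmin (fun _ => le_rfl) hx₀ x
  · rintro q' F' hF' σ ⟨Z, hZ, hσ⟩ ⟨x₀, hx₀⟩ x
    have hiff : ∀ y, F.TangentAt F' σ y ↔ Z y ∈ F'.tangent y := fun y => by
      rw [Foliation.TangentAt, hσ]
      exact Foliation.mkQ_mem_map_iff (hF'.tangent_le y) (Z y)
    exact (hiff x).2
      (hZ.mem_tangent_of_isMinimal hmin hF'.tangent_le ((hiff x₀).1 hx₀) x)
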